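/- Fix a path-loss exponent $\alpha>2$, an outage threshold $\theta>0$ and an integer $K\ge 0$. Consider an uplink cellular network in $\mathbb{R}^2$ seen from a typical base station (BS) $Y_0$ placed at the origin: the other BSs form a homogeneous Poisson point process of density $\lambda_b>0$, and $\Phi$ denotes the set of all BSs including $Y_0$. Given $\Phi$, the active mobiles $(U_Y)_{Y\in\Phi}$ are independent, and $U_Y$ is uniformly distributed in the Voronoi cell of $Y$ with respect to $\Phi$; write $U_0=U_{Y_0}$. All active mobiles transmit with power $p>0$, and a mobile at $u$ is received at $Y_0$ with power $p|u|^{-\alpha}$. The interference from the $K$ interfering mobiles $U_Y$, $Y\ne Y_0$, nearest to $Y_0$ is canceled; let $\mathcal{C}$ be the set of the BSs serving them, and let $$I=\sum_{Y\in\Phi\setminus(\{Y_0\}\cup\mathcal{C})}p|U_Y|^{-\alpha}.$$ With noise variance $\sigma^2\ge 0$, the outage probability of the typical BS is $$P_{\mathsf{out}}=\Pr\left(\frac{p|U_0|^{-\alpha}}{I+\sigma^2}<\theta\right).$$ If the network is interference-limited, that is, $\sigma^2=0$, then $P_{\mathsf{out}}$ does not depend on the BS density $\lambda_b$ or on the mobile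 transmission power $p$: for fixed $\alpha,\theta,K$ it has the same value for all $\lambda_b>0$ and $p>0$. -/

import Mathlib

open MeasureTheory ProbabilityTheory
open scoped ENNReal NNReal

namespace Uplink

/-- The Euclidean plane. -/
abbrev Plane : Type := EuclideanSpace ℝ (Fin 2)

/-- `Φ` is a Poisson point process on `E` with mean measure `Λ`, as a random countable set:
the number of points of `Φ` in a Borel set `B` with `Λ B < ∞` is Poisson with mean `Λ B`, and the
numbers of points in finitely many pairwise disjoint Borel sets are independent. -/
structure IsPoissonPointProcess {Ω E : Type*} [MeasurableSpace Ω] [MeasurableSpace E]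
    (P : Measure Ω) (Λ : Measure E) (Φ : Ω → Set E) : Prop where
  countable : ∀ ω, (Φ ω).Countable
  measurable_count : ∀ B : Set E, MeasurableSet B → Measurable fun ω => (Φ ω ∩ B).encard
  poisson_count : ∀ B : Set E, MeasurableSet B → Λ B ≠ ∞ → ∀ k : ℕ,
    P {ω | (Φ ω ∩ B).encard = k} = poissonMeasure (Λ B).toNNReal {k}
  indep_count : ∀ (m : ℕ) (B : Fin m → Set E), (∀ i, MeasurableSet (B i)) →
    Pairwise (fun i j => Disjoint (B i) (B j)) →
    iIndepFun (fun i ω => (Φ ω ∩ B i).encard) P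

/-- The Voronoi cell of the `n`-th nucleus of the family `y`: the locations to which no other
nucleus is strictly nearer. -/
def voronoiCell (y : ℕ → Plane) (n : ℕ) : Set Plane :=
  {x | ∀ m, dist x (y n) ≤ dist x (y m)}

/-- The uplink cellular network with base-station density `lam`, seen from the typical base
station. The base stations are `Y 0, Y 1, …` and `U n` is the active mobile served by `Y n`.
The typical base station `Y 0` is at the origin, and the others form (in an arbitrary
enumeration) a homogeneous Poisson point process of density `lam`. Given all base-station
locations, the active mobiles are independent and each of them is uniformly distributed in the
Voronoi cell of its base station. -/
structure IsUplinkNetwork {Ω : Type*} [MeasurableSpace Ω] (P : Measure Ω) (lam : ℝ)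
    (Y U : ℕ → Ω → Plane) : Prop where
  measurable_station : ∀ n, Measurable (Y n)
  measurable_mobile : ∀ n, Measurable (U n)
  typical_station : ∀ ω, Y 0 ω = 0
  /-- Different labels denote different base stations. -/
  injective_station : ∀ᵐ ω ∂P, Function.Injective fun n => Y n ω
  poisson_station : IsPoissonPointProcess P (ENNReal.ofReal lam • (volume : Measure Plane))
    fun ω => Set.range fun n => Y (n + 1) ω
  /-- The conditional joint law of the mobiles given the base stations is the product of the
  uniform distributions on the Voronoi cells. -/
  uniform_mobile : ∀ (s : Finset ℕ) (A : ℕ → Set Plane), (∀ n, MeasurableSet (A n)) →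
    ∀ B : Set (ℕ → Plane), MeasurableSet B →
      P {ω | (fun n => Y n ω) ∈ B ∧ ∀ n ∈ s, U n ω ∈ A n} =
        ∫⁻ ω in {ω | (fun n => Y n ω) ∈ B},
          ∏ n ∈ s, (cond volume (voronoiCell (fun m => Y m ω) n)) (A n) ∂P

/-- The power `p |u| ^ (-α)` received at the origin from a mobile at `u` transmitting with
power `p` (infinite when `u = 0`). -/
noncomputable def receivedPower (α p : ℝ) (u : Plane) : ℝ≥0∞ :=
  ENNReal.ofReal p * ‖u‖ₑ ^ (-α)

/-- The labels of the base stations that serve the `K` interfering mobiles nearest to the origin: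
label `n ≠ 0` is included when fewer than `K` interfering mobiles are strictly nearer than
mobile `n`. -/
def canceled (K : ℕ) (u : ℕ → Plane) : Set ℕ :=
  {n | n ≠ 0 ∧ {m | m ≠ 0 ∧ ‖u m‖ < ‖u n‖}.encard < K}

/-- The interference power at the typical base station after cancelation. -/
noncomputable def interference (α p : ℝ) (K : ℕ) (u : ℕ → Plane) : ℝ≥0∞ :=
  ∑' n : {n : ℕ // n ≠ 0 ∧ n ∉ canceled K u}, receivedPower α p (u n)

/-- The signal-to-interference-and-noise ratio at the typical base station, for noise
variance `σsq`. -/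
noncomputable def sinr (α p σsq : ℝ) (K : ℕ) (u : ℕ → Plane) : ℝ≥0∞ :=
  receivedPower α p (u 0) / (interference α p K u + ENNReal.ofReal σsq)

/-- The outage probability of the typical base station. -/
noncomputable def outageProb {Ω : Type*} [MeasurableSpace Ω] (P : Measure Ω)
    (U : ℕ → Ω → Plane) (α θ p σsq : ℝ) (K : ℕ) : ℝ≥0∞ :=
  P {ω | sinr α p σsq K (fun n => U n ω) < ENNReal.ofReal θ}

end Uplink

namespace Uplink

/-! The theorem is a scaling argument. Dilating the plane by `c` turns a network of density `lam`
into one of density `lam / c ^ 2` (`IsUplinkNetwork.smul`). Without noise, a dilation and a change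
of power multiply signal and interference by the same constant, so the SINR is unchanged
(`sinr_smul`). The choice `c ^ 2 = lam₁ / lam₂` reduces the claim to two networks of equal density.

These may live on different probability spaces with different enumerations, so uniqueness in law
remains to be shown (`IsUplinkNetwork.measure_mobile_eq`). The Poisson axioms fix the joint law of
the counts (`IsPoissonPointProcess.map_counts_eq`). The counts in the sublevel sets of an injective
real label recover the stations up to a permutation fixing `0` (`exists_perm_sortedStations`). Given
the stations, the mobiles follow a product measure that is equivariant under relabeling
(`mobileLaw_comp_perm`), and the outage event is invariant under it (`sinr_comp_perm`). -/

/-! ### Counting variables and atoms of a finite family of sets. -/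

theorem measure_enat_top (μ : Measure ℕ∞) [IsProbabilityMeasure μ] :
    μ {⊤} = 1 - ∑' k : ℕ, μ {(k : ℕ∞)} := by
  have hc : ({⊤} : Set ℕ∞) = (⋃ k : ℕ, {(k : ℕ∞)})ᶜ := by
    ext x
    induction x using ENat.recTopCoe <;> simp
  rw [hc, prob_compl_eq_one_sub MeasurableSet.of_discrete, measure_iUnion]
  · intro i j hij
    simpa [Function.onFun] using hij
  · exact fun i => MeasurableSet.of_discrete

theorem measure_enat_ext {μ ν : Measure ℕ∞} [IsProbabilityMeasure μ] [IsProbabilityMeasure ν]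
    (h : ∀ k : ℕ, μ {(k : ℕ∞)} = ν {(k : ℕ∞)}) : μ = ν := by
  refine Measure.ext_of_singleton fun x => ?_
  induction x using ENat.recTopCoe with
  | top => simp_rw [measure_enat_top, h]
  | coe k => exact h k

/-- The points that lie in exactly those sets of the family `A` whose index belongs to `e`. -/
def atom {E ι : Type*} (A : ι → Set E) (e : Finset ι) : Set E := {x | ∀ i, x ∈ A i ↔ i ∈ e}

/-- The atoms are disjoint, and those with `i ∈ e` cover `A i`. This reduces overlapping sets to
disjoint ones. The atom of `∅` is left out because its mean measure may be infinite. -/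
theorem encard_inter_eq_sum_atom {E ι : Type*} [Fintype ι] [DecidableEq ι] (A : ι → Set E)
    (S : Set E) (i : ι) :
    (S ∩ A i).encard =
      ∑ e : {e : Finset ι // e.Nonempty}, if i ∈ e.1 then (S ∩ atom A e.1).encard else 0 := by
  classical
  have hU : S ∩ A i = ⋃ e : {e : Finset ι // e.Nonempty},
      if i ∈ e.1 then S ∩ atom A e.1 else ∅ := by
    ext x
    simp only [Set.mem_iUnion]
    constructor
    · rintro ⟨hS, hx⟩
      refine ⟨⟨Finset.univ.filter fun j => x ∈ A j, ⟨i, by simpa using hx⟩⟩, ?_⟩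
      simp [hx, hS, atom]
    · rintro ⟨e, he⟩
      split_ifs at he with hi
      · exact ⟨he.1, (he.2 i).2 hi⟩
      · exact he.elim
  rw [hU, Set.encard_iUnion_of_finite, finsum_eq_sum_of_fintype]
  · refine Finset.sum_congr rfl fun e _ => ?_
    split_ifs <;> simp
  · intro e f hef
    rw [Function.onFun, Set.disjoint_left]
    intro x hx hy
    split_ifs at hx hy
    · refine hef (Subtype.ext (Finset.ext fun j => ?_))
      exact (hx.2 j).symm.trans (hy.2 j)
    all_goals simp_all

theorem IsPoissonPointProcess.image {Ω E F : Type*} [MeasurableSpace Ω] [MeasurableSpace E]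
    [MeasurableSpace F] {P : Measure Ω} {Λ : Measure E} {Φ : Ω → Set E}
    (h : IsPoissonPointProcess P Λ Φ) (f : E ≃ᵐ F) :
    IsPoissonPointProcess P (Λ.map f) fun ω => f '' Φ ω := by
  have hc : ∀ ω (B : Set F), (f '' Φ ω ∩ B).encard = (Φ ω ∩ f ⁻¹' B).encard := by
    intro ω B
    rw [← Set.image_inter_preimage, f.injective.encard_image]
  constructor
  · exact fun ω => (h.countable ω).image f
  · intro B hB
    simp_rw [hc]
    exact h.measurable_count _ (f.measurable hB)
  · intro B hB hfin k
    simp_rw [hc]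
    rw [f.map_apply] at hfin ⊢
    exact h.poisson_count _ (f.measurable hB) hfin k
  · intro m B hB hd
    simp_rw [hc]
    exact h.indep_count m _ (fun i => f.measurable (hB i)) fun i j hij => (hd hij).preimage f

/-! ### Uniqueness of the joint law of Poisson counts. -/

section Poisson

variable {Ω₁ Ω₂ E : Type*} [MeasurableSpace Ω₁] [MeasurableSpace Ω₂] [MeasurableSpace E]
  {P₁ : Measure Ω₁} {P₂ : Measure Ω₂} [IsProbabilityMeasure P₁] [IsProbabilityMeasure P₂]
  {Λ : Measure E} {Φ₁ : Ω₁ → Set E} {Φ₂ : Ω₂ → Set E}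

/-- The Poisson weights of the finite counts already sum to one, which leaves no mass at `⊤`. -/
theorem IsPoissonPointProcess.ae_finite_inter (h : IsPoissonPointProcess P₁ Λ Φ₁) {B : Set E}
    (hB : MeasurableSet B) (hfin : Λ B ≠ ∞) : ∀ᵐ ω ∂P₁, (Φ₁ ω ∩ B).Finite := by
  have m := h.measurable_count B hB
  have := Measure.isProbabilityMeasure_map (μ := P₁) m.aemeasurable
  have htop := measure_enat_top (P₁.map fun ω => (Φ₁ ω ∩ B).encard)
  have hk : ∀ k : ℕ, P₁.map (fun ω => (Φ₁ ω ∩ B).encard) {(k : ℕ∞)} =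
      poissonMeasure (Λ B).toNNReal {k} := fun k => by
    rw [Measure.map_apply m (MeasurableSet.singleton _)]
    exact h.poisson_count B hB hfin k
  have hsum : ∑' k : ℕ, poissonMeasure (Λ B).toNNReal {k} = 1 := by
    rw [← measure_iUnion (fun i j hij => by simpa [Function.onFun] using hij)
      (fun i => MeasurableSet.singleton i), Set.iUnion_of_singleton, measure_univ]
  simp_rw [hk, hsum, tsub_self] at htop
  rw [Measure.map_apply m (MeasurableSet.singleton _)] at htop
  refine measure_mono_null (fun ω hω => ?_) htop
  exact Set.encard_eq_top_iff.2 hω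

theorem IsPoissonPointProcess.map_count_eq (h₁ : IsPoissonPointProcess P₁ Λ Φ₁)
    (h₂ : IsPoissonPointProcess P₂ Λ Φ₂) {B : Set E} (hB : MeasurableSet B) (hfin : Λ B ≠ ∞) :
    P₁.map (fun ω => (Φ₁ ω ∩ B).encard) = P₂.map (fun ω => (Φ₂ ω ∩ B).encard) := by
  have m₁ := h₁.measurable_count B hB
  have m₂ := h₂.measurable_count B hB
  have := Measure.isProbabilityMeasure_map (μ := P₁) m₁.aemeasurable
  have := Measure.isProbabilityMeasure_map (μ := P₂) m₂.aemeasurable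
  refine measure_enat_ext fun k => ?_
  rw [Measure.map_apply m₁ (MeasurableSet.singleton _),
    Measure.map_apply m₂ (MeasurableSet.singleton _)]
  exact (h₁.poisson_count B hB hfin k).trans (h₂.poisson_count B hB hfin k).symm

theorem IsPoissonPointProcess.map_disjoint_counts_eq_pi {ι : Type*} [Fintype ι]
    (h : IsPoissonPointProcess P₁ Λ Φ₁) {B : ι → Set E} (hB : ∀ i, MeasurableSet (B i))
    (hd : Pairwise fun i j => Disjoint (B i) (B j)) :
    P₁.map (fun ω i => (Φ₁ ω ∩ B i).encard) =
      Measure.pi fun i => P₁.map (fun ω => (Φ₁ ω ∩ B i).encard) := by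
  rw [← iIndepFun_iff_map_fun_eq_pi_map
    (fun i => (h.measurable_count (B i) (hB i)).aemeasurable)]
  let e := Fintype.equivFin ι
  have := h.indep_count _ (fun j => B (e.symm j)) (fun j => hB _)
    (fun i j hij => hd (e.symm.injective.ne hij))
  simpa using this.precomp e.injective

theorem IsPoissonPointProcess.map_disjoint_counts_eq {ι : Type*} [Fintype ι]
    (h₁ : IsPoissonPointProcess P₁ Λ Φ₁)
    (h₂ : IsPoissonPointProcess P₂ Λ Φ₂) {B : ι → Set E} (hB : ∀ i, MeasurableSet (B i))
    (hfin : ∀ i, Λ (B i) ≠ ∞) (hd : Pairwise fun i j => Disjoint (B i) (B j)) :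
    P₁.map (fun ω i => (Φ₁ ω ∩ B i).encard) = P₂.map (fun ω i => (Φ₂ ω ∩ B i).encard) := by
  rw [h₁.map_disjoint_counts_eq_pi hB hd, h₂.map_disjoint_counts_eq_pi hB hd]
  congr 1
  funext i
  exact h₁.map_count_eq h₂ (hB i) (hfin i)

theorem IsPoissonPointProcess.map_counts_eq_of_fintype {ι : Type*} [Fintype ι]
    (h₁ : IsPoissonPointProcess P₁ Λ Φ₁)
    (h₂ : IsPoissonPointProcess P₂ Λ Φ₂) {A : ι → Set E} (hA : ∀ i, MeasurableSet (A i))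
    (hfin : ∀ i, Λ (A i) ≠ ∞) :
    P₁.map (fun ω i => (Φ₁ ω ∩ A i).encard) = P₂.map (fun ω i => (Φ₂ ω ∩ A i).encard) := by
  classical
  let B : {e : Finset ι // e.Nonempty} → Set E := fun e => atom A e.1
  have hB : ∀ e, MeasurableSet (B e) := by
    intro e
    have : B e = ⋂ i, if i ∈ e.1 then A i else (A i)ᶜ := by
      ext x
      simp only [B, atom, Set.mem_iInter]
      refine forall_congr' fun i => ?_
      by_cases hi : i ∈ e.1 <;> simp [hi]
    rw [this]
    refine MeasurableSet.iInter fun i => ?_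
    split_ifs
    · exact hA i
    · exact (hA i).compl
  have hBfin : ∀ e, Λ (B e) ≠ ∞ := by
    rintro ⟨e, i, hi⟩
    exact ne_top_of_le_ne_top (hfin i) (measure_mono fun x hx => (hx i).2 hi)
  have hd : Pairwise fun e f => Disjoint (B e) (B f) := by
    intro e f hef
    rw [Set.disjoint_left]
    intro x hx hy
    exact hef (Subtype.ext (Finset.ext fun j => (hx j).symm.trans (hy j)))
  let F : ({e : Finset ι // e.Nonempty} → ℕ∞) → ι → ℕ∞ := fun c i =>
    ∑ e, if i ∈ e.1 then c e else 0
  have hF : Measurable F := Measurable.of_discrete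
  have m₁ : Measurable fun ω e => (Φ₁ ω ∩ B e).encard :=
    measurable_pi_lambda _ fun e => h₁.measurable_count _ (hB e)
  have m₂ : Measurable fun ω e => (Φ₂ ω ∩ B e).encard :=
    measurable_pi_lambda _ fun e => h₂.measurable_count _ (hB e)
  have := congrArg (Measure.map F) (h₁.map_disjoint_counts_eq h₂ hB hBfin hd)
  rw [Measure.map_map hF m₁, Measure.map_map hF m₂] at this
  convert this using 2
  · ext ω i; exact encard_inter_eq_sum_atom A _ i
  · ext ω i; exact encard_inter_eq_sum_atom A _ i

/-- The joint law of the counts of a Poisson point process in a family of sets of finite mean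
measure is determined by the mean measure. -/
theorem IsPoissonPointProcess.map_counts_eq {ι : Type*}
    (h₁ : IsPoissonPointProcess P₁ Λ Φ₁)
    (h₂ : IsPoissonPointProcess P₂ Λ Φ₂) {A : ι → Set E} (hA : ∀ i, MeasurableSet (A i))
    (hfin : ∀ i, Λ (A i) ≠ ∞) :
    P₁.map (fun ω i => (Φ₁ ω ∩ A i).encard) = P₂.map (fun ω i => (Φ₂ ω ∩ A i).encard) := by
  have m₁ : Measurable fun ω i => (Φ₁ ω ∩ A i).encard :=
    measurable_pi_lambda _ fun i => h₁.measurable_count _ (hA i)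
  have m₂ : Measurable fun ω i => (Φ₂ ω ∩ A i).encard :=
    measurable_pi_lambda _ fun i => h₂.measurable_count _ (hA i)
  -- Both laws are projective limits of the same finite-dimensional marginals.
  refine IsProjectiveLimit.unique
    (P := fun s : Finset ι => P₁.map (fun ω (i : s) => (Φ₁ ω ∩ A i).encard)) ?_ ?_
  · intro s
    rw [Measure.map_map (Finset.measurable_restrict s) m₁]
    rfl
  · intro s
    rw [Measure.map_map (Finset.measurable_restrict s) m₂]
    exact (h₁.map_counts_eq_of_fintype h₂ (A := fun i : s => A i) (fun i => hA i)
      fun i => hfin i).symm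

end Poisson

/-! ### Sorting a locally finite configuration on the line. -/

/-- The `n`-th smallest point (from `n = 0`) of a configuration on the line of which `N q` is the
number of points at most `q`. -/
noncomputable def sortedPoint (N : ℚ → ℕ∞) (n : ℕ) : EReal :=
  ⨅ q : ℚ, if (n : ℕ∞) < N q then ((q : ℝ) : EReal) else ⊤

theorem measurable_sortedPoint : Measurable sortedPoint := by
  refine measurable_pi_lambda _ fun n => ?_
  refine Measurable.iInf fun q => ?_
  exact (measurable_of_countable fun k : ℕ∞ => if (n : ℕ∞) < k then ((q : ℝ) : EReal) else ⊤).comp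
    (measurable_pi_apply q)

/-- An injective sequence of reals with finitely many terms below each bound can be sorted. -/
theorem exists_perm_strictMono {x : ℕ → ℝ} (hx : Function.Injective x)
    (hfin : ∀ t, {j | x j ≤ t}.Finite) : ∃ σ : Equiv.Perm ℕ, StrictMono (x ∘ σ) := by
  have hfin' : ∀ t, {j | x j < t}.Finite := fun t => (hfin t).subset fun j (hj : x j < t) => show x j ≤ t from hj.le
  -- The rank of each term; its inverse will be the sorting permutation.
  let r : ℕ → ℕ := fun m => {j | x j < x m}.ncard
  have hr : ∀ {i j}, x i < x j → r i < r j := by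
    intro i j hij
    refine Set.ncard_lt_ncard ⟨fun k (hk : x k < x i) => show x k < x j from hk.trans hij,
      fun h => ?_⟩ (hfin' _)
    have : i ∈ {k | x k < x i} := h (show x i < x j from hij)
    exact lt_irrefl (x i) this
  have hinj : Function.Injective r := by
    intro i j hij
    by_contra hne
    rcases lt_or_gt_of_ne (hx.ne hne) with h | h
    · exact (hr h).ne hij
    · exact (hr h).ne hij.symm
  -- The largest term below a term of rank `k + 1` has rank `k`. Being infinite and downward closed,
  -- the range of `r` is then all of `ℕ`.
  have hdown : ∀ k, k + 1 ∈ Set.range r → k ∈ Set.range r := by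
    rintro k ⟨m, hm⟩
    have hne : {j | x j < x m}.Nonempty := by
      rw [← Set.ncard_pos (hfin' _)]
      exact (Nat.succ_pos k).trans_eq hm.symm
    obtain ⟨i, hi, hmax⟩ := Set.exists_max_image _ x (hfin' _) hne
    refine ⟨i, ?_⟩
    have : {j | x j < x i} = {j | x j < x m} \ {i} := by
      ext j
      constructor
      · intro hj
        have hj' : x j < x i := hj
        have hi' : x i < x m := hi
        exact ⟨show x j < x m from hj'.trans hi', fun h => hj'.ne (congrArg x h)⟩
      · rintro ⟨hj, hji⟩
        exact lt_of_le_of_ne (hmax j hj) (hx.ne hji)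
    change {j | x j < x i}.ncard = k
    rw [this, Set.ncard_sdiff_singleton_of_mem hi]
    change r m - 1 = k
    omega
  have hlow : ∀ d k, k + d ∈ Set.range r → k ∈ Set.range r := by
    intro d
    induction d with
    | zero => exact fun k h => h
    | succ d ih => exact fun k h => ih k (hdown _ h)
  have hsurj : Function.Surjective r := by
    intro k
    obtain ⟨m, hm, hkm⟩ := (Set.infinite_range_of_injective hinj).exists_gt k
    exact hlow (m - k) k (by rwa [Nat.add_sub_cancel' hkm.le])
  let e := Equiv.ofBijective r ⟨hinj, hsurj⟩
  refine ⟨e.symm, fun a b hab => ?_⟩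
  by_contra hle
  rcases (not_lt.1 hle).lt_or_eq with h | h
  · have := hr h
    change e _ < e _ at this
    simp only [Equiv.apply_symm_apply] at this
    omega
  · exact hab.ne' (e.symm.injective (hx h))

/-- In the increasing enumeration, more than `n` points are at most `t` exactly when the point of
index `n` is; rational thresholds suffice by density. -/
theorem exists_perm_sortedPoint {x : ℕ → ℝ} (hx : Function.Injective x)
    (hfin : ∀ t, {j | x j ≤ t}.Finite) :
    ∃ σ : Equiv.Perm ℕ, ∀ n,
      sortedPoint (fun q => {j | x j ≤ q}.encard) n = (x (σ n) : EReal) := by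
  obtain ⟨σ, hσ⟩ := exists_perm_strictMono hx hfin
  refine ⟨σ, fun n => ?_⟩
  have hcount : ∀ t : ℝ, (n : ℕ∞) < {j | x j ≤ t}.encard ↔ x (σ n) ≤ t := by
    intro t
    have he : {j | x j ≤ t}.encard = {j | x (σ j) ≤ t}.encard := by
      rw [← σ.injective.encard_image {j | x (σ j) ≤ t}]
      congr 1
      ext j
      constructor
      · intro hj
        exact ⟨σ.symm j, by simpa using hj, by simp⟩
      · rintro ⟨i, hi, rfl⟩
        exact hi
    have hI : ∀ m : ℕ, (Set.Iio m).encard = m := fun m => by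
      rw [← Finset.coe_Iio, Set.encard_coe_eq_coe_finsetCard, Nat.card_Iio]
    rw [he]
    constructor
    · intro h
      by_contra hlt
      have hsub : {j | x (σ j) ≤ t} ⊆ Set.Iio n := by
        intro j hj
        by_contra hjn
        exact hlt ((hσ.monotone (not_lt.1 hjn)).trans hj)
      exact absurd h (not_lt.2 ((Set.encard_le_encard hsub).trans (hI n).le))
    · intro h
      have hsub : Set.Iio (n + 1) ⊆ {j | x (σ j) ≤ t} := fun j hj =>
        (hσ.monotone (Nat.lt_succ_iff.1 hj)).trans h
      refine lt_of_lt_of_le ?_ ((hI (n + 1)).symm.le.trans (Set.encard_le_encard hsub))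
      exact_mod_cast Nat.lt_succ_self n
  unfold sortedPoint
  apply le_antisymm
  · refine le_of_forall_gt_imp_ge_of_dense fun b hb => ?_
    obtain ⟨q, hq, hqb⟩ := EReal.lt_iff_exists_rat_btwn.1 hb
    refine (iInf_le _ q).trans ?_
    rw [if_pos ((hcount q).2 (by exact_mod_cast hq.le))]
    exact hqb.le
  · refine le_iInf fun q => ?_
    split_ifs with h
    · exact_mod_cast (hcount q).1 h
    · exact le_top

/-! ### The law of the mobiles given the stations. -/

theorem measurableSet_voronoiCell_prod (n : ℕ) :
    MeasurableSet {q : (ℕ → Plane) × Plane | q.2 ∈ voronoiCell q.1 n} := by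
  have : {q : (ℕ → Plane) × Plane | q.2 ∈ voronoiCell q.1 n} =
      ⋂ m, {q | dist q.2 (q.1 n) ≤ dist q.2 (q.1 m)} := by
    ext q
    simp [voronoiCell]
  rw [this]
  exact MeasurableSet.iInter fun m => measurableSet_le (by fun_prop) (by fun_prop)

theorem measurableSet_voronoiCell (y : ℕ → Plane) (n : ℕ) : MeasurableSet (voronoiCell y n) :=
  measurable_prodMk_left (x := y) (measurableSet_voronoiCell_prod n)

theorem measurable_cond_voronoiCell (n : ℕ) :
    Measurable fun y : ℕ → Plane => cond volume (voronoiCell y n) := by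
  have hvol : ∀ A : Set Plane, MeasurableSet A →
      Measurable fun y : ℕ → Plane => volume (voronoiCell y n ∩ A) := by
    intro A hA
    exact measurable_measure_prodMk_left
      ((measurableSet_voronoiCell_prod n).inter (measurable_snd hA))
  refine Measure.measurable_of_measurable_coe _ fun A hA => ?_
  simp_rw [cond_apply (measurableSet_voronoiCell _ n)]
  refine Measurable.mul (Measurable.inv ?_) (hvol A hA)
  simpa using hvol Set.univ MeasurableSet.univ

open Classical in
/-- The uniform distribution on the `n`-th Voronoi cell if there is one, and a point mass at the
origin if the cell has zero or infinite area. -/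
noncomputable def cellLaw (y : ℕ → Plane) (n : ℕ) : Measure Plane :=
  if cond volume (voronoiCell y n) Set.univ = 1 then cond volume (voronoiCell y n)
  else Measure.dirac 0

instance (y : ℕ → Plane) (n : ℕ) : IsProbabilityMeasure (cellLaw y n) := by
  unfold cellLaw
  split_ifs with h
  · exact ⟨h⟩
  · infer_instance

theorem measurable_cellLaw (n : ℕ) : Measurable fun y => cellLaw y n := by
  refine Measurable.ite ?_ (measurable_cond_voronoiCell n) measurable_const
  exact ((Measure.measurable_coe MeasurableSet.univ).comp (measurable_cond_voronoiCell n))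
    (MeasurableSet.singleton 1)

/-- The joint law of the mobiles given the base stations. -/
noncomputable def mobileLaw (y : ℕ → Plane) : Measure (ℕ → Plane) :=
  Measure.infinitePi fun n => cellLaw y n

instance (y : ℕ → Plane) : IsProbabilityMeasure (mobileLaw y) := by
  unfold mobileLaw
  infer_instance

theorem mobileLaw_pi (y : ℕ → Plane) (s : Finset ℕ) {A : ℕ → Set Plane}
    (hA : ∀ n, MeasurableSet (A n)) :
    mobileLaw y ((s : Set ℕ).pi A) = ∏ n ∈ s, cellLaw y n (A n) :=
  Measure.infinitePi_pi _ fun n _ => hA n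

theorem measurable_mobileLaw : Measurable mobileLaw := by
  refine Measurable.measure_of_isPiSystem_of_isProbabilityMeasure
    generateFrom_squareCylinders.symm
    (isPiSystem_squareCylinders (fun _ => MeasurableSpace.isPiSystem_measurableSet) (by simp)) ?_
  rintro _ ⟨s, A, hA, rfl⟩
  have hA' : ∀ n, MeasurableSet (A n) := fun n => by simpa using hA n
  simp_rw [mobileLaw_pi _ s hA']
  exact Finset.measurable_prod _ fun n _ =>
    (Measure.measurable_coe (hA' n)).comp (measurable_cellLaw n)

theorem voronoiCell_comp_perm (y : ℕ → Plane) (σ : Equiv.Perm ℕ) (n : ℕ) :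
    voronoiCell (y ∘ σ) n = voronoiCell y (σ n) := by
  ext x
  exact σ.forall_congr_left.trans (by simp [voronoiCell]) |>.trans Iff.rfl

theorem cellLaw_comp_perm (y : ℕ → Plane) (σ : Equiv.Perm ℕ) (n : ℕ) :
    cellLaw (y ∘ σ) n = cellLaw y (σ n) := by
  simp only [cellLaw, voronoiCell_comp_perm]

theorem measurable_comp_perm (σ : Equiv.Perm ℕ) : Measurable fun u : ℕ → Plane => u ∘ σ :=
  measurable_pi_lambda _ fun n => measurable_pi_apply (σ n)

theorem mobileLaw_comp_perm (y : ℕ → Plane) (σ : Equiv.Perm ℕ) :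
    mobileLaw (y ∘ σ) = (mobileLaw y).map (fun u => u ∘ σ) := by
  have h := Measure.infinitePi_map_piCongrLeft (fun n => cellLaw y n) σ
  unfold mobileLaw
  conv_rhs => rw [← h]
  rw [Measure.map_map (measurable_comp_perm σ)
    (MeasurableEquiv.measurable _)]
  simp_rw [cellLaw_comp_perm]
  have : (fun u : ℕ → Plane => u ∘ σ) ∘ (MeasurableEquiv.piCongrLeft (fun _ => Plane) σ) = id := by
    funext u n
    exact Equiv.piCongrLeft_apply_apply (fun _ => Plane) σ u n
  rw [this, Measure.map_id]

theorem mobileLaw_comp_perm_apply (y : ℕ → Plane) (σ : Equiv.Perm ℕ) {F : Set (ℕ → Plane)}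
    (hF : MeasurableSet F) (hinv : ∀ u, u ∘ σ ∈ F ↔ u ∈ F) :
    mobileLaw (y ∘ σ) F = mobileLaw y F := by
  rw [mobileLaw_comp_perm, Measure.map_apply (measurable_comp_perm σ) hF]
  congr 1
  ext u
  exact hinv u

section Network

variable {Ω : Type*} [MeasurableSpace Ω] {P : Measure Ω} [IsProbabilityMeasure P] {lam : ℝ}
  {Y U : ℕ → Ω → Plane}

/-- Taking all events trivial in `uniform_mobile` shows that the total mass of the conditioned
measure has integral one. It never exceeds one, so it equals one almost surely and the fallback
value of `cellLaw` is not used. -/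
theorem IsUplinkNetwork.ae_cellLaw_eq (h : IsUplinkNetwork P lam Y U) :
    ∀ᵐ ω ∂P, ∀ n, cellLaw (fun m => Y m ω) n = cond volume (voronoiCell (fun m => Y m ω) n) := by
  rw [ae_all_iff]
  intro n
  have hY : Measurable fun ω m => Y m ω := measurable_pi_lambda _ h.measurable_station
  have hm : Measurable fun ω => cond volume (voronoiCell (fun m => Y m ω) n) Set.univ :=
    (Measure.measurable_coe MeasurableSet.univ).comp ((measurable_cond_voronoiCell n).comp hY)
  have hle : ∀ ω, cond volume (voronoiCell (fun m => Y m ω) n) Set.univ ≤ 1 := by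
    intro ω
    rw [cond_apply (measurableSet_voronoiCell _ n), Set.inter_univ]
    exact ENNReal.inv_mul_le_one _
  have hint := h.uniform_mobile {n} (fun _ => Set.univ) (fun _ => MeasurableSet.univ) Set.univ
    MeasurableSet.univ
  have h1 : ∫⁻ ω, cond volume (voronoiCell (fun m => Y m ω) n) Set.univ ∂P = 1 := by
    simpa using hint.symm
  have h2 : ∫⁻ ω, (1 - cond volume (voronoiCell (fun m => Y m ω) n) Set.univ) ∂P = 0 := by
    rw [lintegral_sub hm (by rw [h1]; simp) (ae_of_all _ hle), h1]
    simp
  rw [lintegral_eq_zero_iff' (hm.aemeasurable.const_sub 1)] at h2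
  filter_upwards [h2] with ω hω
  rw [cellLaw, if_pos]
  exact le_antisymm (hle ω) (tsub_eq_zero_iff_le.1 hω)

theorem IsUplinkNetwork.map_mobile_eq (h : IsUplinkNetwork P lam Y U) {F : Set (ℕ → Plane)}
    (hF : MeasurableSet F) :
    P {ω | (fun n => U n ω) ∈ F} = ∫⁻ ω, mobileLaw (fun n => Y n ω) F ∂P := by
  have hY : Measurable fun ω m => Y m ω := measurable_pi_lambda _ h.measurable_station
  have hU : Measurable fun ω m => U m ω := measurable_pi_lambda _ h.measurable_mobile
  have hκ : Measurable fun ω => mobileLaw fun n => Y n ω := measurable_mobileLaw.comp hY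
  have hlaw : P.map (fun ω n => U n ω) = P.bind fun ω => mobileLaw fun n => Y n ω := by
    have := Measure.isProbabilityMeasure_map (μ := P) hU.aemeasurable
    refine ext_of_generate_finite _ generateFrom_squareCylinders.symm
      (isPiSystem_squareCylinders (fun _ => MeasurableSpace.isPiSystem_measurableSet) (by simp)) ?_ ?_
    · rintro _ ⟨s, A, hA, rfl⟩
      have hA' : ∀ n, MeasurableSet (A n) := fun n => by simpa using hA n
      have hs : MeasurableSet ((s : Set ℕ).pi A) :=
        MeasurableSet.pi s.countable_toSet fun n _ => hA' n
      rw [Measure.map_apply hU hs, Measure.bind_apply hs hκ.aemeasurable]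
      have hint := h.uniform_mobile s A hA' Set.univ MeasurableSet.univ
      simp only [Set.mem_univ, true_and, Set.ofPred_true, Measure.restrict_univ] at hint
      refine Eq.trans ?_ (hint.trans ?_)
      · congr 1
      · refine lintegral_congr_ae ?_
        filter_upwards [h.ae_cellLaw_eq] with ω hω
        simp only [mobileLaw_pi _ s hA', hω]
    · rw [measure_univ, Measure.bind_apply MeasurableSet.univ hκ.aemeasurable]
      simp
  rw [← Measure.bind_apply hF hκ.aemeasurable, ← hlaw, Measure.map_apply hU hF]
  rfl

end Network

/-! ### A canonical enumeration of the stations. -/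

/-- An injective real label of the points of the plane whose sublevel sets are bounded. -/
noncomputable def label (x : Plane) : ℝ := ⌊‖x‖⌋₊ + Real.sigmoid (embeddingReal Plane x)

theorem measurable_label : Measurable label := by
  have h1 : Measurable fun x : Plane => (⌊‖x‖⌋₊ : ℝ) :=
    (measurable_of_countable (fun n : ℕ => (n : ℝ))).comp (Nat.measurable_floor.comp measurable_norm)
  exact h1.add (Real.sigmoid_strictMono.monotone.measurable.comp
    (measurableEmbedding_embeddingReal Plane).measurable)

theorem norm_lt_label_add_one (x : Plane) : ‖x‖ < label x + 1 := by
  have h1 := Nat.lt_floor_add_one ‖x‖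
  have h2 := Real.sigmoid_pos (embeddingReal Plane x)
  unfold label
  linarith

/-- The sigmoid lies strictly between 0 and 1, so the integer part of the label is `⌊‖x‖⌋₊` and the
fractional part encodes the point. -/
theorem label_injective : Function.Injective label := by
  have hfl : ∀ x : Plane, ⌊label x⌋₊ = ⌊‖x‖⌋₊ := by
    intro x
    have h2 := Real.sigmoid_pos (embeddingReal Plane x)
    have h3 := Real.sigmoid_lt_one (embeddingReal Plane x)
    rw [Nat.floor_eq_iff (by unfold label; positivity)]
    constructor <;> (unfold label; linarith)
  intro x y hxy
  have h := hfl x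
  rw [hxy, hfl y] at h
  unfold label at hxy
  rw [h] at hxy
  exact (measurableEmbedding_embeddingReal Plane).injective
    (Real.sigmoid_strictMono.injective (add_left_cancel hxy))

theorem exists_measurable_label_leftInverse :
    ∃ g : ℝ → Plane, Measurable g ∧ ∀ x, g (label x) = x := by
  obtain ⟨g, hg, hgl⟩ := (measurable_label.measurableEmbedding
    label_injective).exists_measurable_extend measurable_id fun _ => inferInstance
  exact ⟨g, hg, fun x => congrFun hgl x⟩

/-- A measurable left inverse of `label`. -/
noncomputable def unlabel : ℝ → Plane := exists_measurable_label_leftInverse.choose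

theorem measurable_unlabel : Measurable unlabel :=
  exists_measurable_label_leftInverse.choose_spec.1

@[simp]
theorem unlabel_label (x : Plane) : unlabel (label x) = x :=
  exists_measurable_label_leftInverse.choose_spec.2 x

/-- The typical station, followed by the other stations in the order of their labels, where `N q`
is the number of these stations with label at most `q`. -/
noncomputable def sortedStations (N : ℚ → ℕ∞) : ℕ → Plane
  | 0 => 0
  | n + 1 => unlabel (sortedPoint N n).toReal

theorem measurable_sortedStations : Measurable sortedStations := by
  refine measurable_pi_lambda _ fun n => ?_
  cases n with
  | zero => exact measurable_const
  | succ n =>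
    exact measurable_unlabel.comp (measurable_ereal_toReal.comp
      ((measurable_pi_apply n).comp measurable_sortedPoint))

/-- The permutation of `ℕ` that fixes `0` and acts as `σ` on the successors. -/
def succPerm (σ : Equiv.Perm ℕ) : Equiv.Perm ℕ where
  toFun n := Nat.casesOn n 0 fun k => σ k + 1
  invFun n := Nat.casesOn n 0 fun k => σ.symm k + 1
  left_inv n := by cases n <;> simp
  right_inv n := by cases n <;> simp

theorem exists_perm_sortedStations {y : ℕ → Plane} (h0 : y 0 = 0) (hy : Function.Injective y)
    (hfin : ∀ k : ℕ, (Set.range (fun n => y (n + 1)) ∩ {x | label x ≤ k}).Finite) :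
    ∃ σ : Equiv.Perm ℕ, σ 0 = 0 ∧ sortedStations
      (fun q : ℚ => (Set.range (fun n => y (n + 1)) ∩ {x | label x ≤ q}).encard) = y ∘ σ := by
  have hinj : Function.Injective fun n => y (n + 1) := fun i j hij => by simpa using hy hij
  have himage : ∀ t : ℝ, Set.range (fun n => y (n + 1)) ∩ {x | label x ≤ t} =
      (fun n => y (n + 1)) '' {j | label (y (j + 1)) ≤ t} := by
    intro t
    rw [← Set.image_univ, ← Set.image_inter_preimage, Set.univ_inter]
    rfl
  have hfin' : ∀ t : ℝ, {j | label (y (j + 1)) ≤ t}.Finite := by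
    intro t
    obtain ⟨k, hk⟩ := exists_nat_ge t
    have := hfin k
    rw [himage] at this
    refine (this.of_finite_image hinj.injOn).subset fun j (hj : _ ≤ t) => ?_
    exact show label (y (j + 1)) ≤ k from hj.trans hk
  obtain ⟨σ, hσ⟩ := exists_perm_sortedPoint (x := fun n => label (y (n + 1)))
    (label_injective.comp hinj) hfin'
  refine ⟨succPerm σ, rfl, ?_⟩
  simp_rw [himage, hinj.encard_image]
  funext n
  cases n with
  | zero => exact h0.symm
  | succ n =>
    simp only [sortedStations, hσ, EReal.toReal_coe, unlabel_label]
    rfl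

/-! ### Uniqueness in law for relabeling-invariant events. -/

section Law

variable {Ω₁ Ω₂ : Type*} [MeasurableSpace Ω₁] [MeasurableSpace Ω₂]
  {P₁ : Measure Ω₁} {P₂ : Measure Ω₂} [IsProbabilityMeasure P₁] [IsProbabilityMeasure P₂]
  {lam : ℝ} {Y₁ U₁ : ℕ → Ω₁ → Plane} {Y₂ U₂ : ℕ → Ω₂ → Plane}

theorem measurableSet_label_le (t : ℝ) : MeasurableSet {x | label x ≤ t} :=
  measurable_label measurableSet_Iic

theorem smul_volume_label_le_ne_top (lam t : ℝ) :
    (ENNReal.ofReal lam • (volume : Measure Plane)) {x | label x ≤ t} ≠ ∞ := by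
  refine ENNReal.mul_ne_top ENNReal.ofReal_ne_top ?_
  refine ne_top_of_le_ne_top (measure_ball_lt_top (x := (0 : Plane)) (r := t + 1)).ne
    (measure_mono fun x hx => ?_)
  have hx' : label x ≤ t := hx
  rw [mem_ball_zero_iff]
  linarith [norm_lt_label_add_one x]

/-- The probability of a permutation-invariant event of the mobiles is the integral of a function
of the counts of the base stations. -/
theorem IsUplinkNetwork.measure_mobile_eq_lintegral (h : IsUplinkNetwork P₁ lam Y₁ U₁)
    {F : Set (ℕ → Plane)} (hF : MeasurableSet F)
    (hinv : ∀ (σ : Equiv.Perm ℕ), σ 0 = 0 → ∀ u, u ∘ σ ∈ F ↔ u ∈ F) :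
    P₁ {ω | (fun n => U₁ n ω) ∈ F} = ∫⁻ N, mobileLaw (sortedStations N) F
      ∂(P₁.map fun ω (q : ℚ) =>
        (Set.range (fun n => Y₁ (n + 1) ω) ∩ {x | label x ≤ q}).encard) := by
  have hN : Measurable fun ω (q : ℚ) =>
      (Set.range (fun n => Y₁ (n + 1) ω) ∩ {x | label x ≤ q}).encard :=
    measurable_pi_lambda _ fun q =>
      h.poisson_station.measurable_count _ (measurableSet_label_le _)
  have hG : Measurable fun N => mobileLaw (sortedStations N) F :=
    (Measure.measurable_coe hF).comp (measurable_mobileLaw.comp measurable_sortedStations)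
  rw [lintegral_map hG hN, h.map_mobile_eq hF]
  refine lintegral_congr_ae ?_
  have hfin := ae_all_iff.2 fun k : ℕ => h.poisson_station.ae_finite_inter
    (measurableSet_label_le k) (smul_volume_label_le_ne_top lam k)
  filter_upwards [h.injective_station, hfin] with ω hi hf
  -- The permutation depends on `ω`, which is harmless since `F` is invariant under every
  -- permutation fixing `0`.
  obtain ⟨σ, h0, hσ⟩ := exists_perm_sortedStations (h.typical_station ω) hi hf
  rw [hσ, mobileLaw_comp_perm_apply _ σ hF (hinv σ h0)]

theorem IsUplinkNetwork.measure_mobile_eq (h₁ : IsUplinkNetwork P₁ lam Y₁ U₁)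
    (h₂ : IsUplinkNetwork P₂ lam Y₂ U₂) {F : Set (ℕ → Plane)} (hF : MeasurableSet F)
    (hinv : ∀ (σ : Equiv.Perm ℕ), σ 0 = 0 → ∀ u, u ∘ σ ∈ F ↔ u ∈ F) :
    P₁ {ω | (fun n => U₁ n ω) ∈ F} = P₂ {ω | (fun n => U₂ n ω) ∈ F} := by
  rw [h₁.measure_mobile_eq_lintegral hF hinv, h₂.measure_mobile_eq_lintegral hF hinv,
    h₁.poisson_station.map_counts_eq h₂.poisson_station (A := fun q : ℚ => {x | label x ≤ q})
      (fun q => measurableSet_label_le q) fun q => smul_volume_label_le_ne_top lam q]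

end Law

/-! ### Measurability and relabeling invariance of the SINR. -/

theorem measurable_receivedPower (α p : ℝ) : Measurable (receivedPower α p) := by
  unfold receivedPower
  fun_prop

theorem measurableSet_mem_canceled (K n : ℕ) :
    MeasurableSet {u : ℕ → Plane | n ∈ canceled K u} := by
  have : {u : ℕ → Plane | n ∈ canceled K u} = {u | n ≠ 0} ∩
      -- At least `K` nearer interferers means that some `K`-element finite set consists of such;
      -- there are countably many candidates.
      (⋃ t : Finset ℕ, ⋃ _ : t.card = K, ⋂ m ∈ t, {u | m ≠ 0 ∧ ‖u m‖ < ‖u n‖})ᶜ := by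
    ext u
    simp only [canceled, Set.mem_inter_iff, Set.mem_compl_iff, Set.mem_iUnion, Set.mem_iInter]
    refine and_congr Iff.rfl ?_
    rw [← not_le, not_iff_not]
    constructor
    · intro h
      obtain ⟨t, ht, hcard⟩ := Set.exists_subset_encard_eq h
      have hfin : t.Finite := Set.finite_of_encard_eq_coe hcard
      refine ⟨hfin.toFinset, ?_, fun m hm => ht (hfin.mem_toFinset.1 hm)⟩
      rw [hfin.encard_eq_coe_toFinset_card] at hcard
      exact_mod_cast hcard
    · rintro ⟨t, rfl, ht⟩
      rw [← Set.encard_coe_eq_coe_finsetCard]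
      exact Set.encard_le_encard fun m hm => ht m hm
  rw [this]
  refine (MeasurableSet.const _).inter (MeasurableSet.compl ?_)
  refine MeasurableSet.iUnion fun t => MeasurableSet.iUnion fun _ =>
    Finset.measurableSet_biInter t fun m _ => (MeasurableSet.const _).inter ?_
  exact measurableSet_lt (measurable_pi_apply m).norm (measurable_pi_apply n).norm

theorem measurable_interference (α p : ℝ) (K : ℕ) : Measurable (interference α p K) := by
  classical
  have : interference α p K = fun u => ∑' n : ℕ,
      if n ≠ 0 ∧ n ∉ canceled K u then receivedPower α p (u n) else 0 := by
    funext u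
    exact (tsum_subtype {n | n ≠ 0 ∧ n ∉ canceled K u} fun n => receivedPower α p (u n)).trans
      (tsum_congr fun n => by simp [Set.indicator_apply])
  rw [this]
  refine Measurable.tsum fun n => Measurable.ite ?_
    ((measurable_receivedPower α p).comp (measurable_pi_apply n)) measurable_const
  exact (MeasurableSet.const _).inter (measurableSet_mem_canceled K n).compl

theorem measurable_sinr (α p σsq : ℝ) (K : ℕ) : Measurable (sinr α p σsq K) :=
  ((measurable_receivedPower α p).comp (measurable_pi_apply 0)).div
    ((measurable_interference α p K).add_const _)

theorem mem_canceled_comp_perm (K : ℕ) (u : ℕ → Plane) {σ : Equiv.Perm ℕ} (h0 : σ 0 = 0) (n : ℕ) :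
    n ∈ canceled K (u ∘ σ) ↔ σ n ∈ canceled K u := by
  have hz : ∀ m, σ m = 0 ↔ m = 0 := fun m => by rw [← σ.injective.eq_iff (a := m), h0]
  have hc : {m | m ≠ 0 ∧ ‖(u ∘ σ) m‖ < ‖(u ∘ σ) n‖}.encard =
      {m | m ≠ 0 ∧ ‖u m‖ < ‖u (σ n)‖}.encard := by
    rw [← σ.injective.encard_image {m | m ≠ 0 ∧ ‖(u ∘ σ) m‖ < ‖(u ∘ σ) n‖}]
    congr 1
    ext m
    rw [σ.image_eq_preimage_symm]
    simp [← hz (σ.symm m)]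
  simp only [canceled, Set.mem_ofPred_eq, hc, ne_eq, hz]

theorem sinr_comp_perm (α p σsq : ℝ) (K : ℕ) (u : ℕ → Plane) {σ : Equiv.Perm ℕ} (h0 : σ 0 = 0) :
    sinr α p σsq K (u ∘ σ) = sinr α p σsq K u := by
  have hz : ∀ m, σ m = 0 ↔ m = 0 := fun m => by rw [← σ.injective.eq_iff (a := m), h0]
  have hI : interference α p K (u ∘ σ) = interference α p K u := by
    refine (σ.subtypeEquiv fun n => ?_).tsum_eq
      fun n : {n // n ≠ 0 ∧ n ∉ canceled K u} => receivedPower α p (u n)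
    rw [mem_canceled_comp_perm K u h0, Ne, Ne, hz]
  simp [sinr, h0, hI]

/-! ### Scaling. -/

theorem receivedPower_smul (α : ℝ) {p q c : ℝ} (hp : 0 < p) (hq : 0 < q) (hc : 0 < c) (u : Plane) :
    receivedPower α q (c • u) =
      ENNReal.ofReal (q / p) * ENNReal.ofReal c ^ (-α) * receivedPower α p u := by
  have hc0 : ENNReal.ofReal c ≠ 0 := by simpa using hc
  have h1 : ‖c • u‖ₑ ^ (-α) = ENNReal.ofReal c ^ (-α) * ‖u‖ₑ ^ (-α) := by
    rw [enorm_smul, Real.enorm_of_nonneg hc.le]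
    -- At the origin the power is `0`, `1` or `∞` according to the sign of `-α`, and
    -- multiplicativity is checked in each case.
    by_cases hu : ‖u‖ₑ = 0
    · rcases lt_trichotomy (-α) 0 with h | h | h
      · simp [hu, ENNReal.zero_rpow_of_neg h, ENNReal.mul_top, ENNReal.rpow_eq_zero_iff, hc, h]
      · simp [h]
      · simp [hu, ENNReal.zero_rpow_of_pos h]
    · exact ENNReal.mul_rpow_of_ne_zero hc0 hu _
  have h2 : ENNReal.ofReal q = ENNReal.ofReal (q / p) * ENNReal.ofReal p := by
    rw [← ENNReal.ofReal_mul (by positivity), div_mul_cancel₀ _ hp.ne']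
  unfold receivedPower
  rw [h1, h2]
  ring

theorem canceled_smul (K : ℕ) {c : ℝ} (hc : 0 < c) (u : ℕ → Plane) :
    canceled K (fun n => c • u n) = canceled K u := by
  simp only [canceled, norm_smul, Real.norm_of_nonneg hc.le, mul_lt_mul_iff_right₀ hc]

/-- Without noise, the SINR is unchanged if all distances are multiplied by a constant and the
common transmission power is changed. -/
theorem sinr_smul (α : ℝ) {p q c : ℝ} (hp : 0 < p) (hq : 0 < q) (hc : 0 < c) (K : ℕ)
    (u : ℕ → Plane) : sinr α q 0 K (fun n => c • u n) = sinr α p 0 K u := by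
  have hc0 : ENNReal.ofReal c ≠ 0 := by simpa using hc
  set k := ENNReal.ofReal (q / p) * ENNReal.ofReal c ^ (-α) with hk
  have hk0 : k ≠ 0 := mul_ne_zero (by simpa using div_pos hq hp)
    (by simp [ENNReal.rpow_eq_zero_iff, hc0])
  have hktop : k ≠ ∞ := ENNReal.mul_ne_top ENNReal.ofReal_ne_top
    (by simp [ENNReal.rpow_eq_top_iff, hc0])
  have hI : interference α q K (fun n => c • u n) = k * interference α p K u := by
    unfold interference
    rw [canceled_smul K hc, ← ENNReal.tsum_mul_left]
    exact tsum_congr fun n => receivedPower_smul α hp hq hc _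
  unfold sinr
  rw [hI, receivedPower_smul α hp hq hc, ← hk]
  simp only [ENNReal.ofReal_zero, add_zero]
  exact ENNReal.mul_div_mul_left _ _ hk0 hktop

theorem voronoiCell_smul {c : ℝ} (hc : 0 < c) (y : ℕ → Plane) (n : ℕ) :
    voronoiCell (fun m => c • y m) n = (MeasurableEquiv.smul₀ c hc.ne') '' voronoiCell y n := by
  ext x
  rw [MeasurableEquiv.image_eq_preimage_symm]
  have hx : ∀ m, dist x (c • y m) = c * dist (c⁻¹ • x) (y m) := by
    intro m
    conv_lhs => rw [← smul_inv_smul₀ hc.ne' x]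
    rw [dist_smul₀, Real.norm_of_nonneg hc.le]
  simp [voronoiCell, hx, mul_le_mul_iff_right₀ hc]

theorem volume_smul₀_image {c : ℝ} (hc : 0 < c) (s : Set Plane) :
    volume ((MeasurableEquiv.smul₀ c hc.ne' : Plane ≃ᵐ Plane) '' s) =
      ENNReal.ofReal (c ^ 2) * volume s := by
  have := Measure.addHaar_smul (volume : Measure Plane) c s
  rw [finrank_euclideanSpace_fin, abs_of_pos (by positivity)] at this
  exact this

/-- Cells dilate with their nuclei, and the area factor `c ^ 2` cancels in the normalization. -/
theorem cond_voronoiCell_smul {c : ℝ} (hc : 0 < c) (y : ℕ → Plane) (n : ℕ) (A : Set Plane) :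
    cond volume (voronoiCell (fun m => c • y m) n) A =
      cond volume (voronoiCell y n) (MeasurableEquiv.smul₀ c hc.ne' ⁻¹' A) := by
  rw [cond_apply (measurableSet_voronoiCell _ n), cond_apply (measurableSet_voronoiCell _ n),
    voronoiCell_smul hc, ← Set.image_inter_preimage, volume_smul₀_image hc, volume_smul₀_image hc]
  have h0 : ENNReal.ofReal (c ^ 2) ≠ 0 := by simpa using hc.ne'
  rw [ENNReal.mul_inv (Or.inl h0) (Or.inl ENNReal.ofReal_ne_top), mul_mul_mul_comm,
    ENNReal.inv_mul_cancel h0 ENNReal.ofReal_ne_top, one_mul]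

theorem IsUplinkNetwork.smul {Ω : Type*} [MeasurableSpace Ω] {P : Measure Ω}
    [IsProbabilityMeasure P] {lam : ℝ} (hlam : 0 < lam) {Y U : ℕ → Ω → Plane}
    (h : IsUplinkNetwork P lam Y U) {c : ℝ} (hc : 0 < c) :
    IsUplinkNetwork P (lam / c ^ 2) (fun n ω => c • Y n ω) (fun n ω => c • U n ω) where
  measurable_station n := (h.measurable_station n).const_smul c
  measurable_mobile n := (h.measurable_mobile n).const_smul c
  typical_station ω := by simp [h.typical_station ω]
  injective_station := by
    filter_upwards [h.injective_station] with ω hω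
    exact (smul_right_injective Plane hc.ne').comp hω
  poisson_station := by
    have hi := h.poisson_station.image (MeasurableEquiv.smul₀ c hc.ne')
    have hΛ : (ENNReal.ofReal lam • (volume : Measure Plane)).map (MeasurableEquiv.smul₀ c hc.ne') =
        ENNReal.ofReal (lam / c ^ 2) • volume := by
      ext s hs
      have := Measure.addHaar_preimage_smul (volume : Measure Plane) hc.ne' s
      rw [finrank_euclideanSpace_fin, abs_of_pos (by positivity)] at this
      rw [MeasurableEquiv.map_apply, Measure.smul_apply, Measure.smul_apply, smul_eq_mul,
        smul_eq_mul, div_eq_mul_inv, ENNReal.ofReal_mul hlam.le, mul_assoc, ← this]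
      rfl
    rw [hΛ] at hi
    convert hi using 2 with ω
    rw [← Set.range_comp]
    rfl
  uniform_mobile s A hA B hB := by
    have hm : Measurable fun y : ℕ → Plane => fun n => c • y n :=
      measurable_pi_lambda _ fun n => (measurable_pi_apply n).const_smul c
    have := h.uniform_mobile s (fun n => MeasurableEquiv.smul₀ c hc.ne' ⁻¹' A n)
      (fun n => (MeasurableEquiv.measurable _) (hA n)) _ (hm hB)
    simp_rw [cond_voronoiCell_smul hc (fun m => Y m _)]
    exact this

end Uplink

theorem proposition2 (α θ : ℝ) (hα : 2 < α) (hθ : 0 < θ) (K : ℕ)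
    (lam₁ lam₂ p₁ p₂ : ℝ) (hlam₁ : 0 < lam₁) (hlam₂ : 0 < lam₂) (hp₁ : 0 < p₁) (hp₂ : 0 < p₂)
    {Ω₁ Ω₂ : Type*} [MeasurableSpace Ω₁] [MeasurableSpace Ω₂]
    (P₁ : MeasureTheory.Measure Ω₁) [MeasureTheory.IsProbabilityMeasure P₁]
    (P₂ : MeasureTheory.Measure Ω₂) [MeasureTheory.IsProbabilityMeasure P₂]
    (Y₁ U₁ : ℕ → Ω₁ → Uplink.Plane) (Y₂ U₂ : ℕ → Ω₂ → Uplink.Plane)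
    (h₁ : Uplink.IsUplinkNetwork P₁ lam₁ Y₁ U₁)
    (h₂ : Uplink.IsUplinkNetwork P₂ lam₂ Y₂ U₂) :
    Uplink.outageProb P₁ U₁ α θ p₁ 0 K = Uplink.outageProb P₂ U₂ α θ p₂ 0 K := by
  -- This dilation factor turns density `lam₁` into `lam₁ / (lam₁ / lam₂) = lam₂`.
  have hc : 0 < √(lam₁ / lam₂) := Real.sqrt_pos.2 (div_pos hlam₁ hlam₂)
  have hs := h₁.smul hlam₁ hc
  rw [Real.sq_sqrt (div_pos hlam₁ hlam₂).le, div_div_cancel₀ hlam₁.ne'] at hs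
  have := hs.measure_mobile_eq h₂
    (F := {u | Uplink.sinr α p₂ 0 K u < ENNReal.ofReal θ})
    (measurableSet_lt (Uplink.measurable_sinr α p₂ 0 K) measurable_const)
    fun σ h0 u => by
      change Uplink.sinr α p₂ 0 K (u ∘ σ) < _ ↔ Uplink.sinr α p₂ 0 K u < _
      rw [Uplink.sinr_comp_perm α p₂ 0 K u h0]
  refine Eq.trans ?_ this
  unfold Uplink.outageProb
  simp_rw [← Uplink.sinr_smul α hp₁ hp₂ hc K]
  rfl
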